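/- Let $d\ge 3$, let $\mathfrak g=\mathrm M_d(\mathbb C)$ be the Lie algebra of complex $d\times d$ matrices with standard basis $(e_{ij})$, and let $\mathcal U(\mathfrak g)$ be its universal enveloping algebra, with coproduct $\Delta$ (the algebra morphism $\mathcal U(\mathfrak g)\to\mathcal U(\mathfrak g)\otimes\mathcal U(\mathfrak g)$ with $\Delta(x)=1\otimes x+x\otimes 1$ for $x\in\mathfrak g$). Let $\rho$ be the standard representation of $\mathfrak g$ on $\mathbb C^d$, $\operatorname{tr}=\frac1d\operatorname{Tr}$, and let $\omega=\operatorname{tr}^{\otimes\infty}$ be the product state on the von Neumann algebra $\mathcal W=\mathrm M_d(\mathbb C)^{\otimes\infty}$, in which $\mathrm M_d(\mathbb C)^{\otimes n}$ is identified with $\mathrm M_d(\mathbb C)^{\otimes n}\otimes I^{\otimes\infty}$. For $n\ge1$ let $j_n=\rho^{\otimes n}:\mathcal U(\mathfrak g)\to\mathrm M_d(\mathbb C)^{\otimes n}\subset\mathcal W$, where $\rho^{\otimes n}=(\rho^{\otimes (n-1)}\otimes\rho)\circ\Delta$ and $\rho^{\otimes 1}=\rho$, and let $P=(\mathrm{id}\otimes(\operatorname{tr}\circ\rho))\circ\Delta:\mathcal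 U(\mathfrak g)\to\mathcal U(\mathfrak g)$. For a subalgebra $\mathcal A$ of $\mathcal U(\mathfrak g)$, say that the restriction of $(j_n)_{n\ge1}$ to $\mathcal A$ defines a quantum Markov process if there is a linear map $Q:\mathcal A\to\mathcal A$ such that \[\omega(j_{n+1}(x)\,\xi)=\omega(j_n(Qx)\,\xi)\] for all $n\ge1$, all $x\in\mathcal A$ and all $\xi$ in the von Neumann algebra generated by $\{j_k(\mathcal A),\,1\le k\le n\}$. (For $\mathcal A=\mathcal U(\mathfrak g)$ this holds with $Q=P$, hence also for every $\mathcal A$ with $P\mathcal A\subset\mathcal A$, with $Q=P|_{\mathcal A}$.) Partition the matrix $E=(e_{ij})_{1\le i,j\le d}$, with entries in $\mathcal U(\mathfrak g)$, into blocks $E_{rs}$, $1\le r,s\le 3$, according to $d=(d-2)+1+1$; thus $E_{11}$ is the upper left $(d-2)\times(d-2)$ block. Write $\mathbf{Tr}(M)=\sum_i m_{ii}$ for a square matrix $M$ with entries in $\mathcal U(\mathfrak g)$, and let $\mathcal B$ be the subalgebra of $\mathcal U(\mathfrak g)$ generated by the constants and the elements \[\mathbf{Tr}(E_{11}^k),\qquad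 \mathbf{Tr}\left(\begin{bmatrix}E_{11}&E_{12}\\E_{21}&E_{22}\end{bmatrix}^k\right),\qquad \mathbf{Tr}(E^k),\qquad k\in\mathbb N.\] Then the restriction of $(j_n)_{n\ge1}$ to $\mathcal B$ does not define a quantum Markov process. Moreover, the element $a=E_{21}E_{12}\,(E_{31}E_{13}+E_{32}E_{23})^2$ lies in $\mathcal B$, whereas $Pa\notin\mathcal B$; in particular $\mathcal B$ is not stable under $P$. -/

import Mathlib

attribute [local instance 100] LieRing.ofAssociativeRing

open scoped TensorProduct Kronecker

noncomputable section

namespace QuantumMinors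

/-! ### The enveloping algebra of `𝔤𝔩_d(ℂ)`, its coproduct, and the Markov operator -/

/-- The universal enveloping algebra of the Lie algebra `𝔤 = M_d(ℂ)`. -/
abbrev U (d : ℕ) : Type := UniversalEnvelopingAlgebra ℂ (Matrix (Fin d) (Fin d) ℂ)

/-- The generator `e_{ij}` of `U d`. -/
def e (d : ℕ) (i j : Fin d) : U d :=
  UniversalEnvelopingAlgebra.ι ℂ (Matrix.single i j (1 : ℂ))

/-- The standard representation `ρ` of `𝔤` on `ℂ^d`, extended to `U d`. -/
def rho (d : ℕ) : U d →ₐ[ℂ] Matrix (Fin d) (Fin d) ℂ :=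
  UniversalEnvelopingAlgebra.lift ℂ LieHom.id

/-- The Lie algebra morphism `x ↦ 1 ⊗ x + x ⊗ 1`. -/
def primitive (d : ℕ) : Matrix (Fin d) (Fin d) ℂ →ₗ⁅ℂ⁆ U d ⊗[ℂ] U d :=
  { (((Algebra.TensorProduct.includeRight : U d →ₐ[ℂ] U d ⊗[ℂ] U d).toLinearMap +
      (Algebra.TensorProduct.includeLeft : U d →ₐ[ℂ] U d ⊗[ℂ] U d).toLinearMap).comp
      (UniversalEnvelopingAlgebra.ι ℂ).toLinearMap) with
    map_lie' := by
      intro x y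
      change 1 ⊗ₜ[ℂ] UniversalEnvelopingAlgebra.ι ℂ ⁅x, y⁆ +
        UniversalEnvelopingAlgebra.ι ℂ ⁅x, y⁆ ⊗ₜ[ℂ] 1 =
          ⁅(1 : U d) ⊗ₜ[ℂ] UniversalEnvelopingAlgebra.ι ℂ x +
            UniversalEnvelopingAlgebra.ι ℂ x ⊗ₜ[ℂ] (1 : U d),
          (1 : U d) ⊗ₜ[ℂ] UniversalEnvelopingAlgebra.ι ℂ y +
            UniversalEnvelopingAlgebra.ι ℂ y ⊗ₜ[ℂ] (1 : U d)⁆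
      rw [LieHom.map_lie]
      simp only [LieRing.of_associative_ring_bracket, mul_add, add_mul,
        Algebra.TensorProduct.tmul_mul_tmul, one_mul, mul_one,
        TensorProduct.tmul_sub, TensorProduct.sub_tmul]
      abel }

theorem primitive_apply (d : ℕ) (x : Matrix (Fin d) (Fin d) ℂ) :
    primitive d x = 1 ⊗ₜ[ℂ] UniversalEnvelopingAlgebra.ι ℂ x +
      UniversalEnvelopingAlgebra.ι ℂ x ⊗ₜ[ℂ] 1 := rfl

/-- The coproduct `Δ : U d → U d ⊗ U d`. -/
def coproduct (d : ℕ) : U d →ₐ[ℂ] U d ⊗[ℂ] U d :=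
  UniversalEnvelopingAlgebra.lift ℂ (primitive d)

/-- The linear form `η = tr ∘ ρ`, with `tr = (1/d) Tr` the normalized trace on `M_d(ℂ)`. -/
def eta (d : ℕ) : U d →ₗ[ℂ] ℂ :=
  (d : ℂ)⁻¹ • (Matrix.traceLinearMap (Fin d) ℂ ℂ).comp (rho d).toLinearMap

/-- The Markov operator `P = (id ⊗ η) ∘ Δ`. -/
def P (d : ℕ) : U d →ₗ[ℂ] U d :=
  (TensorProduct.rid ℂ (U d)).toLinearMap.comp
    (((eta d).lTensor (U d)).comp (coproduct d).toLinearMap)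

/-! ### The quantum random walk -/

/-- The set indexing the standard basis of `(ℂ^d)^{⊗ n}`. -/
def Idx (d : ℕ) : ℕ → Type
  | 0 => Unit
  | n + 1 => Idx d n × Fin d

instance Idx.instFintype (d : ℕ) : (n : ℕ) → Fintype (Idx d n)
  | 0 => inferInstanceAs (Fintype Unit)
  | n + 1 =>
    haveI := Idx.instFintype d n
    inferInstanceAs (Fintype (Idx d n × Fin d))

instance Idx.instDecidableEq (d : ℕ) : (n : ℕ) → DecidableEq (Idx d n)
  | 0 => inferInstanceAs (DecidableEq Unit)
  | n + 1 =>
    haveI := Idx.instDecidableEq d n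
    inferInstanceAs (DecidableEq (Idx d n × Fin d))

/-- The algebra `M_d(ℂ)^{⊗ n}`, that is, the first `n` factors
`M_d(ℂ)^{⊗ n} ⊗ I^{⊗ ∞}` of the infinite tensor product `𝒲 = M_d(ℂ)^{⊗ ∞}`. -/
abbrev W (d n : ℕ) : Type := Matrix (Idx d n) (Idx d n) ℂ

/-- The product state `ω = tr^{⊗ ∞}` on the first `n` factors: the normalized trace. -/
def omega (d n : ℕ) (x : W d n) : ℂ := ((d : ℂ) ^ n)⁻¹ * Matrix.trace x

/-- The inclusion `a ↦ a ⊗ I` of the first `n` factors in the first `n + 1` factors. -/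
def embed (d n : ℕ) : W d n →ₐ[ℂ] W d (n + 1) where
  toFun a := (a ⊗ₖ (1 : Matrix (Fin d) (Fin d) ℂ) :
    Matrix (Idx d n × Fin d) (Idx d n × Fin d) ℂ)
  map_one' := Matrix.one_kronecker_one
  map_mul' a b := by
    have h := Matrix.mul_kronecker_mul a b (1 : Matrix (Fin d) (Fin d) ℂ)
      (1 : Matrix (Fin d) (Fin d) ℂ)
    rw [mul_one] at h
    exact h
  map_zero' := Matrix.zero_kronecker _
  map_add' a b := Matrix.add_kronecker a b _
  commutes' r := by
    have h := Matrix.smul_kronecker r (1 : W d n) (1 : Matrix (Fin d) (Fin d) ℂ)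
    rw [Matrix.one_kronecker_one] at h
    rw [Algebra.algebraMap_eq_smul_one, Algebra.algebraMap_eq_smul_one]
    exact h

/-- The inclusion `b ↦ I^{⊗ n} ⊗ b` of the factor of rank `n + 1` in the first `n + 1`
factors. -/
def embedLast (d n : ℕ) : Matrix (Fin d) (Fin d) ℂ →ₐ[ℂ] W d (n + 1) where
  toFun b := ((1 : W d n) ⊗ₖ b : Matrix (Idx d n × Fin d) (Idx d n × Fin d) ℂ)
  map_one' := Matrix.one_kronecker_one
  map_mul' a b := by
    have h := Matrix.mul_kronecker_mul (1 : W d n) (1 : W d n) a b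
    rw [mul_one] at h
    exact h
  map_zero' := Matrix.kronecker_zero _
  map_add' a b := Matrix.kronecker_add _ a b
  commutes' r := by
    have h := Matrix.kronecker_smul r (1 : W d n) (1 : Matrix (Fin d) (Fin d) ℂ)
    rw [Matrix.one_kronecker_one] at h
    rw [Algebra.algebraMap_eq_smul_one, Algebra.algebraMap_eq_smul_one]
    exact h

theorem embed_commute (d n : ℕ) (a : W d n) (b : Matrix (Fin d) (Fin d) ℂ) :
    embed d n a * embedLast d n b = embedLast d n b * embed d n a := by
  have h₁ := Matrix.mul_kronecker_mul a (1 : W d n) (1 : Matrix (Fin d) (Fin d) ℂ) b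
  have h₂ := Matrix.mul_kronecker_mul (1 : W d n) a b (1 : Matrix (Fin d) (Fin d) ℂ)
  rw [mul_one, one_mul] at h₁ h₂
  exact h₁.symm.trans h₂

/-- The morphism `f ⊗ g : U d ⊗ U d → M_d(ℂ)^{⊗ n} ⊗ M_d(ℂ)` attached to two morphisms `f`, `g`. -/
def tensorHom (d n : ℕ) (f : U d →ₐ[ℂ] W d n) (g : U d →ₐ[ℂ] Matrix (Fin d) (Fin d) ℂ) :
    U d ⊗[ℂ] U d →ₐ[ℂ] W d (n + 1) :=
  Algebra.TensorProduct.lift ((embed d n).comp f) ((embedLast d n).comp g)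
    fun x y => embed_commute d n (f x) (g y)

theorem tensorHom_tmul (d n : ℕ) (f : U d →ₐ[ℂ] W d n)
    (g : U d →ₐ[ℂ] Matrix (Fin d) (Fin d) ℂ) (x y : U d) :
    tensorHom d n f g (x ⊗ₜ[ℂ] y) = embed d n (f x) * embedLast d n (g y) :=
  Algebra.TensorProduct.lift_tmul _ _ _ x y

/-- The morphisms `j_n = ρ^{⊗ n}`, defined by `ρ^{⊗ (n + 1)} = (ρ^{⊗ n} ⊗ ρ) ∘ Δ`.
For `n = 0` this is the trivial representation. -/
def j (d : ℕ) : (n : ℕ) → U d →ₐ[ℂ] W d n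
  | 0 => UniversalEnvelopingAlgebra.lift ℂ 0
  | n + 1 => (tensorHom d n (j d n) (rho d)).comp (coproduct d)

/-- The set `⋃_{1 ≤ k ≤ n} j_k(B)`, all of it seen in the first `n` factors. -/
def pastSet (d : ℕ) (B : Subalgebra ℂ (U d)) : (n : ℕ) → Set (W d n)
  | 0 => ∅
  | n + 1 => embed d n '' pastSet d B n ∪ j d (n + 1) '' (B : Set (U d))

/-- The von Neumann algebra generated by `j_k(B)`, `1 ≤ k ≤ n`, as the bicommutant in the algebra
`M_d(ℂ)^{⊗ n}` of all operators on `(ℂ^d)^{⊗ n}` (`StarSubalgebra.centralizer ℂ S` is the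
commutant of `S ∪ S*`). -/
def past (d : ℕ) (B : Subalgebra ℂ (U d)) (n : ℕ) : StarSubalgebra ℂ (W d n) :=
  StarSubalgebra.centralizer ℂ
    (StarSubalgebra.centralizer ℂ (pastSet d B n) : Set (W d n))

/-- The restriction of `(j_n)_{n ≥ 1}` to the subalgebra `B` is a quantum Markov chain: there is a
transition operator `Q : B → B` such that `ω(j_{n+1}(x) ξ) = ω(j_n(Q x) ξ)` for all `n ≥ 1`,
all `x ∈ B`, and all `ξ` in the von Neumann algebra generated by `j_k(B)`, `1 ≤ k ≤ n`. -/
def RestrictsToMarkov (d : ℕ) (B : Subalgebra ℂ (U d)) : Prop :=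
  ∃ Q : B →ₗ[ℂ] B, ∀ n : ℕ, 1 ≤ n → ∀ x : B, ∀ ξ ∈ past d B n,
    omega d (n + 1) (j d (n + 1) (x : U d) * embed d n ξ) =
      omega d n (j d n (Q x : U d) * ξ)

/-! ### The partition of `E = (e_{ij})` into blocks of sizes `d - 2`, `1`, `1` -/

/-- The matrix `E = (e_{ij})` with entries in `U d`. -/
def E (d : ℕ) : Matrix (Fin d) (Fin d) (U d) := Matrix.of (e d)

/-- The block (numbered `1`, `2` or `3`) of an index: the last index is in block `3`, the one
before it in block `2`, the others in block `1`. -/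
def blockOf (d : ℕ) (i : Fin d) : ℕ :=
  if (i : ℕ) + 2 < d then 1 else if (i : ℕ) + 2 = d then 2 else 3

/-- The block `E_{rs}` of `E`. -/
def block (d r s : ℕ) :
    Matrix {i : Fin d // blockOf d i = r} {i : Fin d // blockOf d i = s} (U d) :=
  (E d).submatrix Subtype.val Subtype.val

/-- The subalgebra generated by the constants and the `Tr (E_{11}^k)`,
`Tr ([[E_{11}, E_{12}], [E_{21}, E_{22}]]^k)` and `Tr (E^k)`, `k ∈ ℕ`. -/
def minorAlgebra (d : ℕ) : Subalgebra ℂ (U d) :=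
  Algebra.adjoin ℂ
    (Set.range (fun k : ℕ => Matrix.trace (block d 1 1 ^ k)) ∪
      Set.range (fun k : ℕ => Matrix.trace
        (Matrix.fromBlocks (block d 1 1) (block d 1 2) (block d 2 1) (block d 2 2) ^ k)) ∪
      Set.range (fun k : ℕ => Matrix.trace (E d ^ k)))

/-- The element `E_{21} E_{12} (E_{31} E_{13} + E_{32} E_{23})²`; each product of blocks in it is a
`1 × 1` matrix, identified with its only entry through the trace. -/
def witness (d : ℕ) : U d :=
  Matrix.trace (block d 2 1 * block d 1 2) *
    (Matrix.trace (block d 3 1 * block d 1 3) + Matrix.trace (block d 3 2 * block d 2 3)) ^ 2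

end QuantumMinors

end

/-!
Let `X = ∑_{k ∈ S} e_{mk} e_{km}` and let `Y` be the same element for `n` and `S ∪ {m}`. The Casimir
elements of the chain `𝔤𝔩_S ⊆ 𝔤𝔩_{S ∪ {m}} ⊆ 𝔤𝔩_{S ∪ {m, n}}` generate an algebra `B`, in which `X`
and `Y` are obtained by comparing the quadratic Casimir elements of consecutive terms; `B` is the
algebra of the theorem when `S` is the first block, and then the element `a` is `X Y²`. Moreover `X`
is central in `B`, as it lies in the enveloping algebra of `𝔤𝔩_{S ∪ {m}}` and commutes with `𝔤𝔩_S`.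

Up to the factor `d`, `P` is the trace of the matrix `(id ⊗ ρ) ∘ Δ`. This matrix is a scalar matrix
plus a sparse one both for `X` and for `Y`, which gives `d P(X Y²)` as the sum of terms commuting
with `X` and of an explicit `D`. The operator `j_3([X, D])` has the matrix coefficient `1 - 2 |S|`
from `b_m ⊗ b_n ⊗ b_k` to `b_k ⊗ b_m ⊗ b_n`, `k ∈ S`. It is nonzero, so `P(X Y²)` does not commute
with `X` and is not in `B`.

If `Q` were a transition operator on `B`, then `ω(j_n(P a) ξ) = ω(j_n(Q a) ξ)` for all `ξ` in the
past. For `ξ = [ζ, j_n(X)]` this says `ω(j_n([X, P a]) ζ) = ω(j_n([X, Q a]) ζ) = 0`, as `Q a ∈ B`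
commutes with `X`. For `n = 3`, the past contains the operator `ζ` that sends `b_k ⊗ b_m ⊗ b_n` to
`b_m ⊗ b_n ⊗ b_k` for `k ∈ S` and kills the other basis vectors; it picks exactly the coefficients
above, and `ω(j_3([X, P a]) ζ)` is a nonzero multiple of `|S| (1 - 2 |S|)`.
-/

namespace QuantumMinors

open Matrix

section Algebra

variable {d : ℕ}

theorem lie_mul_eq {A : Type*} [Ring A] (x y z : A) : ⁅x, y * z⁆ = ⁅x, y⁆ * z + y * ⁅x, z⁆ := by
  simp only [Ring.lie_def]
  noncomm_ring

theorem commute_trace_pow {A κ : Type*} [Ring A] [Fintype κ] [DecidableEq κ] {x : A}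
    {M : Matrix κ κ A} (h : ∀ i k, Commute x (M i k)) (p : ℕ) : Commute x (M ^ p).trace := by
  have hM : Commute (scalar κ x) M := scalar_commute_iff.2 (Matrix.ext h)
  have hMp : ∀ i, Commute x ((M ^ p) i i) := fun i =>
    congrFun₂ (scalar_commute_iff.1 (hM.pow_right p)) i i
  exact Commute.sum_right _ _ _ fun i _ => hMp i

theorem lie_e_e (k l i j : Fin d) :
    ⁅e d k l, e d i j⁆ = (if l = i then e d k j else 0) - (if j = k then e d i l else 0) := by
  have single_mul_single (a b r s : Fin d) : single a b (1 : ℂ) * single r s 1 =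
      if b = r then single a s 1 else 0 := by
    split_ifs with h
    · rw [h, single_mul_single_same, one_mul]
    · exact single_mul_single_of_ne _ _ _ _ h _
  rw [e, e, ← LieHom.map_lie, Ring.lie_def, single_mul_single, single_mul_single, map_sub]
  simp only [apply_ite (UniversalEnvelopingAlgebra.ι ℂ), map_zero, e]

/-- The principal submatrix `E_R` of `E` with rows and columns in `R`. -/
def principal (d : ℕ) (R : Finset (Fin d)) : Matrix R R (U d) :=
  (E d).submatrix Subtype.val Subtype.val

/-- The Casimir element `Tr (E_R ^ p)` of the subalgebra `𝔤𝔩_R` of `𝔤𝔩_d`. -/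
def casimir (d : ℕ) (R : Finset (Fin d)) (p : ℕ) : U d :=
  (principal d R ^ p).trace

theorem lie_e_principal_pow (R : Finset (Fin d)) (p : ℕ) (k l i j : R) :
    ⁅e d k l, (principal d R ^ p) i j⁆ =
      (if l = i then (principal d R ^ p) k j else 0) -
        (if j = k then (principal d R ^ p) i l else 0) := by
  induction p generalizing i j with
  | zero =>
    simp only [pow_zero, one_apply]
    by_cases hij : i = j <;> by_cases hli : l = i <;> by_cases hjk : j = k <;>
      simp_all [eq_comm, Ring.lie_def]
  | succ p ih =>
    have entry (q : R) : ⁅e d k l, principal d R q j⁆ =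
        (if l = q then principal d R k j else 0) - (if j = k then principal d R q l else 0) := by
      simp only [Subtype.ext_iff]
      exact lie_e_e (k : Fin d) l q j
    simp only [pow_succ, mul_apply, lie_sum, lie_mul_eq, ih, entry, sub_mul, mul_sub, ite_mul,
      mul_ite, zero_mul, mul_zero, Finset.sum_add_distrib, Finset.sum_sub_distrib,
      Finset.sum_ite_eq, Finset.sum_ite_eq', Finset.mem_univ, if_true, Finset.sum_ite_irrel,
      Finset.sum_const_zero]
    abel

theorem commute_e_casimir {R : Finset (Fin d)} {k l : Fin d} (hk : k ∈ R) (hl : l ∈ R) (p : ℕ) :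
    Commute (e d k l) (casimir d R p) := by
  have lie_diag := fun i => lie_e_principal_pow R p ⟨k, hk⟩ ⟨l, hl⟩ i i
  simp only [commute_iff_lie_eq, casimir, trace, diag_apply, lie_sum, lie_diag,
    Finset.sum_sub_distrib, Finset.sum_ite_eq, Finset.sum_ite_eq', Finset.mem_univ, if_true,
    sub_self]

theorem casimir_one (R : Finset (Fin d)) : casimir d R 1 = ∑ k ∈ R, e d k k := by
  rw [casimir, pow_one]
  exact Finset.sum_coe_sort R fun k => e d k k

theorem casimir_two (R : Finset (Fin d)) :
    casimir d R 2 = ∑ i ∈ R, ∑ k ∈ R, e d i k * e d k i := by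
  simp only [casimir, pow_two, trace, diag_apply, mul_apply, ← Finset.sum_coe_sort R]
  rfl

theorem trace_submatrix_pow {κ : Type*} [Fintype κ] [DecidableEq κ] {f : κ → Fin d}
    (hf : Function.Injective f) {R : Finset (Fin d)} (hR : Set.range f = R) (p : ℕ) :
    ((E d).submatrix f f ^ p).trace = casimir d R p := by
  let σ : κ ≃ R := (Equiv.ofInjective f hf).trans (Equiv.setCongr hR)
  have hσ : reindexAlgEquiv ℂ (U d) σ ((E d).submatrix f f) = principal d R := by
    have f_symm (i : R) : f (σ.symm i) = i := congrArg Subtype.val (σ.apply_symm_apply i)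
    ext i k
    exact congrArg₂ (e d) (f_symm i) (f_symm k)
  rw [casimir, ← hσ, ← map_pow, coe_reindexAlgEquiv]
  exact (σ.symm.sum_comp _).symm

/-- The quadratic element `∑_{k ∈ S} e_{rk} e_{kr}`: the product of the row `r` and the column `r`
of `E`, both restricted to `S`. -/
def rowCol (d : ℕ) (r : Fin d) (S : Finset (Fin d)) : U d :=
  ∑ k ∈ S, e d r k * e d k r

theorem commute_rowCol_e {r : Fin d} {S : Finset (Fin d)} (hr : r ∉ S) {k l : Fin d}
    (hk : k ∈ S) (hl : l ∈ S) : Commute (rowCol d r S) (e d k l) := by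
  have hlr : l ≠ r := fun h => hr (h ▸ hl)
  have hrk : r ≠ k := fun h => hr (h ▸ hk)
  symm
  simp only [commute_iff_lie_eq, rowCol, lie_sum, lie_mul_eq, lie_e_e, hlr, hrk, if_false, zero_sub,
    sub_zero, mul_ite, neg_mul, ite_mul, zero_mul, mul_zero, Finset.sum_add_distrib,
    Finset.sum_neg_distrib, Finset.sum_ite_eq, Finset.sum_ite_eq', hk, hl, if_true,
    neg_add_cancel]

theorem commute_rowCol_of_forall_e {r : Fin d} {S R : Finset (Fin d)} (hr : r ∈ R) (hS : S ⊆ R)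
    {x : U d} (hx : ∀ k ∈ R, ∀ l ∈ R, Commute (e d k l) x) : Commute (rowCol d r S) x :=
  Commute.sum_left _ _ _ fun k hk => (hx r hr k (hS hk)).mul_left (hx k (hS hk) r hr)

theorem commute_rowCol_casimir {r : Fin d} {S R : Finset (Fin d)} (hr : r ∈ R) (hS : S ⊆ R)
    (p : ℕ) : Commute (rowCol d r S) (casimir d R p) :=
  commute_rowCol_of_forall_e hr hS fun _ hk _ hl => commute_e_casimir hk hl p

theorem commute_rowCol_casimir_self {r : Fin d} {S : Finset (Fin d)} (hr : r ∉ S) (p : ℕ) :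
    Commute (rowCol d r S) (casimir d S p) :=
  commute_trace_pow (fun i k => commute_rowCol_e hr i.2 k.2) p

theorem sum_e_mul_e_swap (r : Fin d) (S : Finset (Fin d)) :
    ∑ k ∈ S, e d k r * e d r k = rowCol d r S + (casimir d S 1 - S.card • e d r r) := by
  have swap (k : Fin d) : e d k r * e d r k = e d r k * e d k r + (e d k k - e d r r) := by
    simpa [Ring.lie_def, sub_eq_iff_eq_add'] using lie_e_e k r r k
  simp only [swap, Finset.sum_add_distrib, Finset.sum_sub_distrib, Finset.sum_const, rowCol,
    casimir_one]

theorem casimir_one_insert {r : Fin d} {R : Finset (Fin d)} (hr : r ∉ R) :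
    casimir d (insert r R) 1 = e d r r + casimir d R 1 := by
  simp only [casimir_one, Finset.sum_insert hr]

theorem casimir_two_insert {r : Fin d} {R : Finset (Fin d)} (hr : r ∉ R) :
    casimir d (insert r R) 2 = casimir d R 2 + 2 • rowCol d r R + e d r r * e d r r +
      (casimir d R 1 - R.card • e d r r) := by
  simp only [casimir_two, Finset.sum_insert hr, Finset.sum_add_distrib, sum_e_mul_e_swap]
  rw [rowCol, two_nsmul]
  abel

theorem e_mem_of_casimir_mem {B : Subalgebra ℂ (U d)} {r : Fin d} {R : Finset (Fin d)}
    (hr : r ∉ R) (hR : ∀ p, casimir d R p ∈ B) (hrR : ∀ p, casimir d (insert r R) p ∈ B) :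
    e d r r ∈ B := by
  simpa [casimir_one_insert hr] using sub_mem (hrR 1) (hR 1)

theorem rowCol_mem_of_casimir_mem {B : Subalgebra ℂ (U d)} {r : Fin d} {R : Finset (Fin d)}
    (hr : r ∉ R) (hR : ∀ p, casimir d R p ∈ B) (hrR : ∀ p, casimir d (insert r R) p ∈ B) :
    rowCol d r R ∈ B := by
  have he : e d r r ∈ B := e_mem_of_casimir_mem hr hR hrR
  have h2 : 2 • rowCol d r R = casimir d (insert r R) 2 - casimir d R 2 - e d r r * e d r r -
      (casimir d R 1 - R.card • e d r r) := by
    rw [casimir_two_insert hr]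
    abel
  have hB : 2 • rowCol d r R ∈ B := h2 ▸ sub_mem
    (sub_mem (sub_mem (hrR 2) (hR 2)) (mul_mem he he)) (sub_mem (hR 1) (nsmul_mem he _))
  rw [← Nat.cast_smul_eq_nsmul ℂ] at hB
  simpa [smul_smul] using B.smul_mem hB (2⁻¹ : ℂ)

end Algebra

section MarkovOperator

variable {d : ℕ}

/-- The coproduct with `ρ` applied to its second factor, as a matrix with entries in `U d`. -/
def matrixCoproduct (d : ℕ) : U d →ₐ[ℂ] Matrix (Fin d) (Fin d) (U d) :=
  (matrixEquivTensor (Fin d) ℂ (U d)).symm.toAlgHom.comp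
    ((Algebra.TensorProduct.map (AlgHom.id ℂ (U d)) (rho d)).comp (coproduct d))

theorem coproduct_e (k l : Fin d) : coproduct d (e d k l) = 1 ⊗ₜ e d k l + e d k l ⊗ₜ 1 := by
  rw [e, coproduct, UniversalEnvelopingAlgebra.lift_ι_apply, primitive_apply]

theorem rho_e (k l : Fin d) : rho d (e d k l) = single k l 1 := by
  rw [e, rho, UniversalEnvelopingAlgebra.lift_ι_apply, LieHom.id_apply]

theorem matrixCoproduct_e (k l : Fin d) :
    matrixCoproduct d (e d k l) = scalar (Fin d) (e d k l) + single k l 1 := by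
  change (matrixEquivTensor (Fin d) ℂ (U d)).symm (Algebra.TensorProduct.map (AlgHom.id ℂ (U d))
    (rho d) (coproduct d (e d k l))) = _
  rw [coproduct_e, map_add, Algebra.TensorProduct.map_tmul, Algebra.TensorProduct.map_tmul,
    rho_e, map_add, map_one, map_one, add_comm]
  refine congrArg₂ (· + ·) ?_ ?_ <;> ext i i'
  · simp [one_apply, diagonal_apply]
  · simp

theorem P_eq_trace_matrixCoproduct (x : U d) :
    P d x = (d : ℂ)⁻¹ • (matrixCoproduct d x).trace := by
  have on_tensor (z : U d ⊗[ℂ] U d) : TensorProduct.rid ℂ (U d) ((eta d).lTensor (U d) z) =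
      (d : ℂ)⁻¹ • ((matrixEquivTensor (Fin d) ℂ (U d)).symm
        (Algebra.TensorProduct.map (AlgHom.id ℂ (U d)) (rho d) z)).trace := by
    induction z using TensorProduct.induction_on with
    | zero => simp
    | add y z hy hz => simp only [map_add, trace_add, smul_add, hy, hz]
    | tmul y z =>
      simp [eta, trace, Finset.sum_smul, ← Algebra.commutes _ y, ← Algebra.smul_def]
  exact on_tensor (coproduct d x)

theorem trace_scalar_mul {A κ : Type*} [Semiring A] [Fintype κ] [DecidableEq κ] (a : A)
    (M : Matrix κ κ A) : (scalar κ a * M).trace = a * M.trace := by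
  simp [trace, diagonal_mul, Finset.mul_sum]

theorem trace_mul_scalar {A κ : Type*} [Semiring A] [Fintype κ] [DecidableEq κ] (a : A)
    (M : Matrix κ κ A) : (M * scalar κ a).trace = M.trace * a := by
  simp [trace, mul_diagonal, Finset.sum_mul]

theorem lie_e_trace_matrixCoproduct (k l : Fin d) (x : U d) :
    ⁅e d k l, (matrixCoproduct d x).trace⁆ = (matrixCoproduct d ⁅e d k l, x⁆).trace := by
  simp only [Ring.lie_def, map_sub, map_mul, matrixCoproduct_e, add_mul, mul_add, trace_sub,
    trace_add, trace_scalar_mul, trace_mul_scalar, trace_mul_single,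
    trace_single_mul, MulOpposite.op_one, one_smul]
  abel

theorem commute_e_trace_matrixCoproduct {k l : Fin d} {x : U d} (h : Commute (e d k l) x) :
    Commute (e d k l) (matrixCoproduct d x).trace := by
  rw [commute_iff_lie_eq] at h ⊢
  rw [lie_e_trace_matrixCoproduct, h, map_zero, trace_zero]

/-- The part of `matrixCoproduct d (rowCol d r S)` that is not scalar. -/
def hook (d : ℕ) (r : Fin d) (S : Finset (Fin d)) : Matrix (Fin d) (Fin d) (U d) :=
  single r r (S.card : U d) + ∑ k ∈ S, (single r k (e d k r) + single k r (e d r k))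

theorem matrixCoproduct_rowCol (r : Fin d) (S : Finset (Fin d)) :
    matrixCoproduct d (rowCol d r S) = scalar (Fin d) (rowCol d r S) + hook d r S := by
  have scalar_mul_single (a : U d) (k l : Fin d) :
      scalar (Fin d) a * single k l 1 = single k l a := by
    ext i i'
    simp [single_apply]
  have single_mul_scalar (a : U d) (k l : Fin d) :
      single k l 1 * scalar (Fin d) a = single k l a := by
    ext i i'
    simp [single_apply]
  have term (k : Fin d) : matrixCoproduct d (e d r k * e d k r) =
      scalar (Fin d) (e d r k * e d k r) +
        (single r r 1 + (single r k (e d k r) + single k r (e d r k))) := by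
    simp only [map_mul, matrixCoproduct_e, add_mul, mul_add, scalar_mul_single, single_mul_scalar,
      single_mul_single_same, one_mul]
    abel
  simp only [rowCol, hook, map_sum, term, Finset.sum_add_distrib, Finset.sum_const, smul_single,
    nsmul_one]

theorem trace_hook_mul (r : Fin d) (S : Finset (Fin d)) (A : Matrix (Fin d) (Fin d) (U d)) :
    (hook d r S * A).trace =
      S.card • A r r + ∑ k ∈ S, (e d k r * A k r + e d r k * A r k) := by
  simp only [hook, add_mul, Finset.sum_mul, trace_add, trace_sum, trace_single_mul, nsmul_eq_mul,
    smul_eq_mul]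

theorem matrixCoproduct_rowCol_sq_apply {r i l : Fin d} {S : Finset (Fin d)} (hr : r ∉ S)
    (hi : i ∈ S) (hl : l ∈ S) :
    matrixCoproduct d (rowCol d r S ^ 2) i l =
      (if i = l then rowCol d r S ^ 2 else 0) + e d r i * e d l r := by
  have hir : i ≠ r := fun h => hr (h ▸ hi)
  have hlr : l ≠ r := fun h => hr (h ▸ hl)
  have hook_row (q : Fin d) : hook d r S i q = if q = r then e d r i else 0 := by
    simp [hook, Matrix.sum_apply, single_apply, hi, hir.symm, ite_and, eq_comm]
  have hook_col (q : Fin d) : hook d r S q l = if q = r then e d l r else 0 := by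
    simp [hook, Matrix.sum_apply, single_apply, hl, hlr.symm, eq_comm, ite_and]
  have hook_sq : (hook d r S * hook d r S) i l = e d r i * e d l r := by
    simp [mul_apply, hook_row, hook_col]
  rw [map_pow, matrixCoproduct_rowCol]
  simp [sq, add_mul, mul_add, hook_sq, hook_row, hlr, diagonal_apply]

/-- The part of `d P(X Y²)`, for `X = rowCol d m S` and `Y = rowCol d n (insert m S)`, that does not
commute with `X`. -/
def defect (d : ℕ) (m n : Fin d) (S : Finset (Fin d)) : U d :=
  S.card • (e d n m * e d m n) +
    ∑ k ∈ S, (e d k m * (e d n k * e d m n) + e d m k * (e d n m * e d k n))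

theorem trace_matrixCoproduct_rowCol_mul_rowCol_sq {m n : Fin d} {S : Finset (Fin d)} (hm : m ∉ S)
    (hn : n ∉ insert m S) :
    (matrixCoproduct d (rowCol d m S * rowCol d n (insert m S) ^ 2)).trace =
      rowCol d m S * (matrixCoproduct d (rowCol d n (insert m S) ^ 2)).trace +
        S.card • rowCol d n (insert m S) ^ 2 + defect d m n S := by
  have ne_of_mem (k : Fin d) (hk : k ∈ S) : k ≠ m := fun h => hm (h ▸ hk)
  have entry {i l : Fin d} := matrixCoproduct_rowCol_sq_apply hn (i := i) (l := l)
  rw [map_mul, matrixCoproduct_rowCol, add_mul, trace_add, trace_scalar_mul, trace_hook_mul,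
    add_assoc, defect]
  have hmm : m ∈ insert m S := Finset.mem_insert_self m S
  congr 1
  rw [entry hmm hmm, if_pos rfl, smul_add, add_assoc]
  congr 2
  refine Finset.sum_congr rfl fun k hk => ?_
  have hkT := Finset.mem_insert_of_mem hk (b := m)
  rw [entry hkT hmm, entry hmm hkT, if_neg (ne_of_mem k hk), if_neg (ne_of_mem k hk).symm,
    zero_add, zero_add]

theorem lie_rowCol_trace_matrixCoproduct {m n : Fin d} {S : Finset (Fin d)} (hm : m ∉ S)
    (hn : n ∉ insert m S) :
    ⁅rowCol d m S, (matrixCoproduct d (rowCol d m S * rowCol d n (insert m S) ^ 2)).trace⁆ =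
      ⁅rowCol d m S, defect d m n S⁆ := by
  have hmT := Finset.mem_insert_self m S
  have hST := Finset.subset_insert m S
  have commute_e_sq : ∀ k ∈ insert m S, ∀ l ∈ insert m S,
      Commute (e d k l) (rowCol d n (insert m S) ^ 2) :=
    fun k hk l hl => ((commute_rowCol_e hn hk hl).symm).pow_right 2
  have h_scalar : Commute (rowCol d m S)
      (rowCol d m S * (matrixCoproduct d (rowCol d n (insert m S) ^ 2)).trace) :=
    (Commute.refl _).mul_right <| commute_rowCol_of_forall_e hmT hST fun k hk l hl =>
      commute_e_trace_matrixCoproduct (commute_e_sq k hk l hl)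
  have h_sq : Commute (rowCol d m S) (S.card • rowCol d n (insert m S) ^ 2) :=
    (commute_rowCol_of_forall_e hmT hST commute_e_sq).smul_right _
  rw [trace_matrixCoproduct_rowCol_mul_rowCol_sq hm hn, lie_add, lie_add, h_scalar.lie_eq,
    h_sq.lie_eq, zero_add, zero_add]

end MarkovOperator

section Kets

variable {d n : ℕ}

/-- The map `v ↦ v ⊗ b_t`, with `b_t` the basis vector of label `t`. -/
def appendKet (t : Fin d) : (Idx d n → ℂ) →ₗ[ℂ] (Idx d (n + 1) → ℂ) where
  toFun v := fun p : Idx d n × Fin d => v p.1 * (Pi.single t 1 : Fin d → ℂ) p.2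
  map_add' _ _ := funext fun _ => add_mul _ _ _
  map_smul' _ _ := funext fun _ => mul_assoc _ _ _

theorem kronecker_mulVec_appendKet (A : W d n) (B : Matrix (Fin d) (Fin d) ℂ) (t : Fin d)
    (v : Idx d n → ℂ) (p : Idx d n × Fin d) :
    ((A ⊗ₖ B : Matrix (Idx d n × Fin d) (Idx d n × Fin d) ℂ) *ᵥ appendKet t v) p =
      (A *ᵥ v) p.1 * B p.2 t := by
  change ∑ q : Idx d n × Fin d, A p.1 q.1 * B p.2 q.2 *
    (v q.1 * (Pi.single t 1 : Fin d → ℂ) q.2) = _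
  simp [Fintype.sum_prod_type, Pi.single_apply, mulVec, dotProduct, Finset.sum_mul, mul_right_comm]

theorem embed_mulVec_appendKet (A : W d n) (t : Fin d) (v : Idx d n → ℂ) :
    embed d n A *ᵥ appendKet t v = appendKet t (A *ᵥ v) :=
  funext fun p => by
    refine (kronecker_mulVec_appendKet A 1 t v p).trans (congrArg _ ?_)
    rw [one_apply, Pi.single_apply]

theorem embedLast_single_mulVec_appendKet (k l t : Fin d) (v : Idx d n → ℂ) :
    embedLast d n (single k l 1) *ᵥ appendKet t v = if l = t then appendKet k v else 0 :=
  funext fun p => by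
    refine (kronecker_mulVec_appendKet 1 (single k l 1) t v p).trans ?_
    rw [one_mulVec]
    split_ifs with h
    · rw [h]
      change v p.1 * single k t 1 p.2 t = v p.1 * (Pi.single k 1 : Fin d → ℂ) p.2
      simp [single_apply, Pi.single_apply, eq_comm]
    · change v p.1 * single k l 1 p.2 t = 0
      rw [single_apply_of_col_ne _ _ h, mul_zero]

theorem j_zero_e (k l : Fin d) : j d 0 (e d k l) = 0 := by
  rw [j, e, UniversalEnvelopingAlgebra.lift_ι_apply, LieHom.zero_apply]

theorem j_succ_e (k l : Fin d) :
    j d (n + 1) (e d k l) = embed d n (j d n (e d k l)) + embedLast d n (single k l 1) := by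
  rw [j, AlgHom.comp_apply, coproduct_e, map_add, tensorHom_tmul, tensorHom_tmul, rho_e, map_one,
    map_one, map_one, map_one, one_mul, mul_one]
  exact add_comm _ _

theorem j_succ_e_mulVec_appendKet (k l t : Fin d) (v : Idx d n → ℂ) :
    j d (n + 1) (e d k l) *ᵥ appendKet t v =
      appendKet t (j d n (e d k l) *ᵥ v) + if l = t then appendKet k v else 0 := by
  rw [j_succ_e, add_mulVec, embed_mulVec_appendKet, embedLast_single_mulVec_appendKet]

/-- The basis vector `b_a ⊗ b_b ⊗ b_c` of `(ℂ^d)^{⊗ 3}`. -/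
def ket (a b c : Fin d) : Idx d 3 → ℂ :=
  appendKet c (appendKet b (appendKet a (fun _ : Idx d 0 => 1)))

theorem j_three_e_mulVec_ket (k l a b c : Fin d) :
    j d 3 (e d k l) *ᵥ ket a b c =
      (if l = a then ket k b c else 0) + (if l = b then ket a k c else 0) +
        (if l = c then ket a b k else 0) := by
  simp only [ket, j_succ_e_mulVec_appendKet (n := 2), j_succ_e_mulVec_appendKet (n := 1),
    j_succ_e_mulVec_appendKet (n := 0), j_zero_e, zero_mulVec, map_zero, zero_add, map_add,
    apply_ite (appendKet _)]

theorem j_three_rowCol_mulVec_ket (r : Fin d) (S : Finset (Fin d)) (a b c : Fin d) :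
    j d 3 (rowCol d r S) *ᵥ ket a b c =
      (if r = a then S.card • ket a b c + (if b ∈ S then ket b a c else 0) +
        (if c ∈ S then ket c b a else 0) else 0) +
      (if r = b then S.card • ket a b c + (if a ∈ S then ket b a c else 0) +
        (if c ∈ S then ket a c b else 0) else 0) +
      (if r = c then S.card • ket a b c + (if a ∈ S then ket c b a else 0) +
        (if b ∈ S then ket a c b else 0) else 0) := by
  have mulVec_ite (A : W d 3) (p : Prop) [Decidable p] (v : Idx d 3 → ℂ) :
      A *ᵥ (if p then v else 0) = if p then A *ᵥ v else 0 := by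
    rw [apply_ite (A *ᵥ ·), mulVec_zero]
  have summand (k : Fin d) : j d 3 (e d r k * e d k r) *ᵥ ket a b c =
      (if r = a then ket a b c + (if k = b then ket k a c else 0) +
        (if k = c then ket k b a else 0) else 0) +
      (if r = b then (if k = a then ket b k c else 0) + ket a b c +
        (if k = c then ket a k b else 0) else 0) +
      (if r = c then (if k = a then ket c b k else 0) + (if k = b then ket a c k else 0) +
        ket a b c else 0) := by
    rw [map_mul, ← mulVec_mulVec, j_three_e_mulVec_ket]
    simp only [mulVec_add, mulVec_ite, j_three_e_mulVec_ket, if_true]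
    refine congrArg₂ (· + ·) (congrArg₂ (· + ·) ?_ ?_) ?_
    · by_cases h : r = a <;> simp [h]
    · by_cases h : r = b <;> simp [h]
    · by_cases h : r = c <;> simp [h]
  simp only [rowCol, map_sum, sum_mulVec, summand, Finset.sum_add_distrib, Finset.sum_ite_irrel,
    Finset.sum_ite_eq', Finset.sum_const, nsmul_zero, add_comm _ (S.card • _), ← add_assoc]

end Kets

section Entry

variable {d : ℕ}

/-- The label of the basis vector `ket a b c`. -/
def triple (a b c : Fin d) : Idx d 3 :=
  (((((), a) : Unit × Fin d), b), c)

theorem ket_apply_triple (a b c a' b' c' : Fin d) :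
    ket a b c (triple a' b' c') = if a' = a ∧ b' = b ∧ c' = c then 1 else 0 := by
  change ((1 * (Pi.single a 1 : Fin d → ℂ) a') * (Pi.single b 1 : Fin d → ℂ) b') *
    (Pi.single c 1 : Fin d → ℂ) c' = _
  simp only [Pi.single_apply, ite_and, mul_ite, mul_one, mul_zero]
  split_ifs <;> rfl

theorem ket_eq_single (a b c : Fin d) : ket a b c = Pi.single (triple a b c) 1 := by
  ext ⟨⟨⟨⟨⟩, a'⟩, b'⟩, c'⟩
  have h_triple : triple a' b' c' = triple a b c ↔ a' = a ∧ b' = b ∧ c' = c :=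
    Prod.mk_inj.trans <| (and_congr_left' <| Prod.mk_inj.trans <| and_congr_left' <|
      Prod.mk_inj.trans <| and_iff_right rfl).trans and_assoc
  refine (ket_apply_triple a b c a' b' c').trans (Eq.trans ?_
    (Pi.single_apply (triple a b c) (1 : ℂ) (triple a' b' c')).symm)
  simp only [h_triple]

theorem mulVec_ket_apply (A : W d 3) (a b c : Fin d) (p : Idx d 3) :
    (A *ᵥ ket a b c) p = A p (triple a b c) := by
  rw [ket_eq_single, mulVec_single_one, col_apply]

theorem ext_mulVec_ket {A B : W d 3} (h : ∀ a b c, A *ᵥ ket a b c = B *ᵥ ket a b c) : A = B := by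
  ext p ⟨⟨⟨⟨⟩, a⟩, b⟩, c⟩
  exact (mulVec_ket_apply A a b c p).symm.trans <|
    (congrFun (h a b c) p).trans (mulVec_ket_apply B a b c p)

variable {m n k : Fin d} {S : Finset (Fin d)}

/-- Stated for any `K` on which `𝔤𝔩_d` acts as on `ket`, so that it also applies to the kets with
their labels permuted. -/
theorem j_three_defect_mulVec (hm : m ∉ S) (hn : n ∉ S) (hmn : m ≠ n) (hk : k ∈ S)
    {K : Fin d → Fin d → Fin d → Idx d 3 → ℂ}
    (hK : ∀ i l a b c, j d 3 (e d i l) *ᵥ K a b c = (if l = a then K i b c else 0) +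
      (if l = b then K a i c else 0) + (if l = c then K a b i else 0)) :
    j d 3 (defect d m n S) *ᵥ K m n k =
      (2 * S.card) • K n m k + S.card • K m n k + K n k m + K k m n + K m k n := by
  have ne_m {l : Fin d} (hl : l ∈ S) : l ≠ m := fun h => hm (h ▸ hl)
  have ne_n {l : Fin d} (hl : l ∈ S) : l ≠ n := fun h => hn (h ▸ hl)
  have h_corner : j d 3 (e d n m * e d m n) *ᵥ K m n k = K n m k + K m n k := by
    rw [map_mul, ← mulVec_mulVec]
    simp [hK, hmn.symm, (ne_n hk).symm, (ne_m hk).symm]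
  have h_left (l : Fin d) (hl : l ∈ S) : j d 3 (e d l m * (e d n l * e d m n)) *ᵥ K m n k =
      if l = k then K k m n + K m k n else 0 := by
    rw [map_mul, map_mul, ← mulVec_mulVec, ← mulVec_mulVec]
    split_ifs with hlk
    · simp [hlk, hK, hmn, hmn.symm, (ne_n hk).symm, ne_m hk]
    · simp [hlk, hK, hmn.symm, (ne_n hk).symm, ne_m hl]
  have h_right (l : Fin d) (hl : l ∈ S) : j d 3 (e d m l * (e d n m * e d l n)) *ᵥ K m n k =
      K n m k + if l = k then K n k m else 0 := by
    rw [map_mul, map_mul, ← mulVec_mulVec, ← mulVec_mulVec]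
    by_cases hlk : l = k
    · simp [hlk, hK, hmn.symm, (ne_n hk).symm, (ne_m hk).symm, ne_n hk]
    · simp [hlk, hK, hmn.symm, (ne_n hk).symm, (ne_m hk).symm, (ne_m hl).symm, ne_n hl]
  simp only [defect, map_add, map_sum, map_nsmul, add_mulVec, sum_mulVec, smul_mulVec, h_corner]
  rw [Finset.sum_congr rfl fun l hl => congrArg₂ (· + ·) (h_left l hl) (h_right l hl)]
  simp only [Finset.sum_add_distrib, Finset.sum_ite_eq', Finset.sum_const, hk, if_true]
  module

theorem j_three_lie_rowCol_defect_apply (hm : m ∉ S) (hn : n ∉ S) (hmn : m ≠ n) (hk : k ∈ S) :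
    j d 3 ⁅rowCol d m S, defect d m n S⁆ (triple k m n) (triple m n k) = 1 - 2 * S.card := by
  have hkm : k ≠ m := fun h => hm (h ▸ hk)
  have hkn : k ≠ n := fun h => hn (h ▸ hk)
  have h_mnk := j_three_defect_mulVec hm hn hmn hk j_three_e_mulVec_ket
  have h_knm := j_three_defect_mulVec hm hn hmn hk (K := fun a b c => ket c b a)
    fun i l a b c => by rw [j_three_e_mulVec_ket]; abel
  rw [← mulVec_ket_apply (j d 3 _), Ring.lie_def, map_sub, map_mul, map_mul, sub_mulVec,
    ← mulVec_mulVec, ← mulVec_mulVec, h_mnk]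
  simp only [j_three_rowCol_mulVec_ket, mulVec_add, mulVec_smul, h_knm, h_mnk, hn, hm, hk,
    hmn, hkm.symm, if_true, if_false, add_zero, zero_add]
  simp [ket_apply_triple, hmn, hkm, hkn, hmn.symm, hkm.symm, hkn.symm]

end Entry

section Markov

variable {d n : ℕ}

theorem omega_j_succ_mul_embed (x : U d) (ξ : W d n) :
    omega d (n + 1) (j d (n + 1) x * embed d n ξ) = omega d n (j d n (P d x) * ξ) := by
  have trace_embed_mul_embedLast (A : W d n) (B : Matrix (Fin d) (Fin d) ℂ) :
      (embed d n A * embedLast d n B).trace = A.trace * B.trace := by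
    have h : embed d n A * embedLast d n B =
        (A ⊗ₖ B : Matrix (Idx d n × Fin d) (Idx d n × Fin d) ℂ) :=
      (mul_kronecker_mul A 1 1 B).symm.trans (by rw [mul_one, one_mul])
    rw [h]
    exact trace_kronecker A B
  have on_tensor (z : U d ⊗[ℂ] U d) :
      omega d (n + 1) (tensorHom d n (j d n) (rho d) z * embed d n ξ) =
        omega d n (j d n (TensorProduct.rid ℂ (U d) ((eta d).lTensor (U d) z)) * ξ) := by
    induction z using TensorProduct.induction_on with
    | zero => simp [omega]
    | add y z hy hz =>
      simp only [omega, map_add, add_mul, trace_add, mul_add] at hy hz ⊢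
      rw [hy, hz]
    | tmul y z =>
      rw [tensorHom_tmul, mul_assoc, ← embed_commute, ← mul_assoc, ← map_mul, omega,
        trace_embed_mul_embedLast]
      simp only [omega, eta, pow_succ, _root_.mul_inv_rev, LinearMap.lTensor_smul,
        LinearMap.smul_apply, LinearMap.lTensor_tmul, LinearMap.coe_comp, AlgHom.coe_toLinearMap,
        Function.comp_apply, traceLinearMap_apply, map_smul, TensorProduct.rid_tmul,
        Algebra.smul_mul_assoc, trace_smul, smul_eq_mul]
      ring
  exact on_tensor (coproduct d x)

theorem omega_lie_mul (a b c : W d n) : omega d n (⁅a, b⁆ * c) = omega d n (b * ⁅c, a⁆) := by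
  rw [omega, omega, Ring.lie_def, Ring.lie_def, sub_mul, mul_sub, trace_sub, trace_sub, mul_assoc a,
    trace_mul_comm a, mul_assoc, mul_assoc]

theorem j_mem_pastSet {B : Subalgebra ℂ (U d)} {x : U d} (hx : x ∈ B) :
    j d (n + 1) x ∈ pastSet d B (n + 1) :=
  Or.inr ⟨x, hx, rfl⟩

theorem embed_mem_pastSet {B : Subalgebra ℂ (U d)} {a : W d n} (ha : a ∈ pastSet d B n) :
    embed d n a ∈ pastSet d B (n + 1) :=
  Or.inl ⟨a, ha, rfl⟩

theorem pastSet_subset_past (B : Subalgebra ℂ (U d)) : pastSet d B n ⊆ past d B n := by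
  refine fun a ha => StarSubalgebra.mem_centralizer_iff ℂ |>.2 fun b hb => ?_
  have commute_a {b : W d n} (hb : b ∈ StarSubalgebra.centralizer ℂ (pastSet d B n)) :
      b * a = a * b :=
    (StarSubalgebra.mem_centralizer_iff ℂ |>.1 hb a ha).1.symm
  exact ⟨commute_a hb, commute_a (star_mem hb)⟩

theorem RestrictsToMarkov.omega_j_lie_P_mul_eq_zero {B : Subalgebra ℂ (U d)}
    (hB : RestrictsToMarkov d B) {c x : U d} (hc : c ∈ B) (hcB : ∀ y ∈ B, Commute c y) (hx : x ∈ B)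
    {ζ : W d (n + 1)} (hζ : ζ ∈ past d B (n + 1)) :
    omega d (n + 1) (j d (n + 1) ⁅c, P d x⁆ * ζ) = 0 := by
  obtain ⟨Q, hQ⟩ := hB
  have hξ : ⁅ζ, j d (n + 1) c⁆ ∈ past d B (n + 1) := by
    have hjc := pastSet_subset_past B (j_mem_pastSet (n := n) hc)
    exact sub_mem (mul_mem hζ hjc) (mul_mem hjc hζ)
  have map_lie (y : U d) : j d (n + 1) ⁅c, y⁆ = ⁅j d (n + 1) c, j d (n + 1) y⁆ := by
    simp only [Ring.lie_def, map_sub, map_mul]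
  calc omega d (n + 1) (j d (n + 1) ⁅c, P d x⁆ * ζ)
    _ = omega d (n + 1) (j d (n + 1) (P d x) * ⁅ζ, j d (n + 1) c⁆) := by
      rw [map_lie, omega_lie_mul]
    _ = omega d (n + 1) (j d (n + 1) (Q ⟨x, hx⟩) * ⁅ζ, j d (n + 1) c⁆) := by
      rw [← omega_j_succ_mul_embed, ← hQ (n + 1) n.succ_pos ⟨x, hx⟩ _ hξ]
    _ = 0 := by
      rw [← omega_lie_mul, ← map_lie, (hcB _ (Q ⟨x, hx⟩).2).lie_eq, map_zero, zero_mul, omega,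
        trace_zero, mul_zero]

end Markov

section Chain

variable {d : ℕ}

/-- The algebra generated by the Casimir elements of the subalgebras in the chain
`𝔤𝔩_S ⊆ 𝔤𝔩_{S ∪ {m}} ⊆ 𝔤𝔩_{S ∪ {m, n}}` of `𝔤𝔩_d`. -/
def chainAlgebra (d : ℕ) (m n : Fin d) (S : Finset (Fin d)) : Subalgebra ℂ (U d) :=
  Algebra.adjoin ℂ (Set.range (casimir d S) ∪ Set.range (casimir d (insert m S)) ∪
    Set.range (casimir d (insert n (insert m S))))

variable {m n : Fin d} {S : Finset (Fin d)}

theorem casimir_mem_chainAlgebra {R : Finset (Fin d)}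
    (hR : R = S ∨ R = insert m S ∨ R = insert n (insert m S)) (p : ℕ) :
    casimir d R p ∈ chainAlgebra d m n S :=
  Algebra.subset_adjoin <| by
    rcases hR with rfl | rfl | rfl <;> simp

theorem rowCol_mem_chainAlgebra_left (hm : m ∉ S) : rowCol d m S ∈ chainAlgebra d m n S :=
  rowCol_mem_of_casimir_mem hm (casimir_mem_chainAlgebra (.inl rfl))
    (casimir_mem_chainAlgebra (.inr (.inl rfl)))

theorem rowCol_mem_chainAlgebra_right (hn : n ∉ insert m S) :
    rowCol d n (insert m S) ∈ chainAlgebra d m n S :=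
  rowCol_mem_of_casimir_mem hn (casimir_mem_chainAlgebra (.inr (.inl rfl)))
    (casimir_mem_chainAlgebra (.inr (.inr rfl)))

theorem e_mem_chainAlgebra_left (hm : m ∉ S) : e d m m ∈ chainAlgebra d m n S :=
  e_mem_of_casimir_mem hm (casimir_mem_chainAlgebra (.inl rfl))
    (casimir_mem_chainAlgebra (.inr (.inl rfl)))

theorem e_mem_chainAlgebra_right (hn : n ∉ insert m S) : e d n n ∈ chainAlgebra d m n S :=
  e_mem_of_casimir_mem hn (casimir_mem_chainAlgebra (.inr (.inl rfl)))
    (casimir_mem_chainAlgebra (.inr (.inr rfl)))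

theorem commute_rowCol_of_mem_chainAlgebra (hm : m ∉ S) {x : U d}
    (hx : x ∈ chainAlgebra d m n S) : Commute (rowCol d m S) x := by
  have h_le : chainAlgebra d m n S ≤ Subalgebra.centralizer ℂ {rowCol d m S} := by
    refine Algebra.adjoin_le ?_
    simp only [Set.union_subset_iff, Set.range_subset_iff, SetLike.mem_coe,
      Subalgebra.mem_centralizer_iff, Set.mem_singleton_iff, forall_eq]
    refine ⟨⟨commute_rowCol_casimir_self hm, commute_rowCol_casimir ?_ ?_⟩,
      commute_rowCol_casimir ?_ ?_⟩
    all_goals grind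
  exact Subalgebra.mem_centralizer_iff ℂ |>.1 (h_le hx) _ rfl

end Chain

section CycleOp

variable {d : ℕ} {m n : Fin d} {S : Finset (Fin d)}

/-- The operator on `(ℂ^d)^{⊗ 3}` sending `ket k m n` to `ket m n k` for `k ∈ S`, and all other
basis vectors to `0`. -/
def cycleOp (d : ℕ) (m n : Fin d) (S : Finset (Fin d)) : W d 3 :=
  ∑ k ∈ S, single (triple m n k) (triple k m n) 1

theorem trace_mul_cycleOp (A : W d 3) :
    (A * cycleOp d m n S).trace = ∑ k ∈ S, A (triple k m n) (triple m n k) := by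
  simp [cycleOp, Finset.mul_sum, trace_sum, Matrix.trace_mul_single]

theorem cycleOp_mulVec_ket (a b c : Fin d) :
    cycleOp d m n S *ᵥ ket a b c = if a ∈ S ∧ b = m ∧ c = n then ket m n a else 0 := by
  have summand (k : Fin d) : single (triple m n k) (triple k m n) (1 : ℂ) *ᵥ ket a b c =
      if k = a then (if b = m ∧ c = n then ket m n a else 0) else 0 := by
    have h := single_mulVec (triple m n k) (triple k m n) (1 : ℂ) (ket a b c)
    rw [ket_apply_triple, one_mul] at h
    refine h.trans ?_
    rw [ket_eq_single]
    by_cases hk : k = a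
    · subst hk
      by_cases h_eq : b = m ∧ c = n
      · simp only [h_eq, and_self, if_true]
        rfl
      · simp [h_eq, eq_comm (a := m), eq_comm (a := n)]
    · simp [hk]
  simp only [cycleOp, sum_mulVec, summand, Finset.sum_ite_eq', ite_and]

/-- The operator multiplying `ket a b c` by the number of occurrences of `r` in `[a]`. -/
def countOne (d : ℕ) (r : Fin d) : W d 3 :=
  embed d 2 (embed d 1 (j d 1 (e d r r)))

/-- The operator multiplying `ket a b c` by the number of occurrences of `r` in `[a, b]`. -/
def countTwo (d : ℕ) (r : Fin d) : W d 3 :=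
  embed d 2 (j d 2 (e d r r))

theorem countOne_mulVec_ket (r a b c : Fin d) :
    countOne d r *ᵥ ket a b c = (if r = a then 1 else 0 : ℂ) • ket a b c := by
  simp only [countOne, ket, embed_mulVec_appendKet, j_succ_e_mulVec_appendKet (n := 0), j_zero_e,
    zero_mulVec, map_zero, zero_add]
  split_ifs with h <;> simp [h]

theorem countTwo_mulVec_ket (r a b c : Fin d) :
    countTwo d r *ᵥ ket a b c =
      ((if r = a then 1 else 0) + if r = b then 1 else 0 : ℂ) • ket a b c := by
  simp only [countTwo, ket, embed_mulVec_appendKet, j_succ_e_mulVec_appendKet (n := 1),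
    j_succ_e_mulVec_appendKet (n := 0), j_zero_e, zero_mulVec, map_zero, zero_add, map_add,
    add_smul]
  congr 1
  all_goals split_ifs with h <;> simp [h]

theorem countOne_mul_countTwo_mulVec_ket (hmn : m ≠ n) (a b c : Fin d) :
    (countOne d m * countTwo d n) *ᵥ ket a b c = if m = a ∧ n = b then ket a b c else 0 := by
  simp only [← mulVec_mulVec, countTwo_mulVec_ket, mulVec_smul, countOne_mulVec_ket]
  split_ifs <;> first | simp; done | grind

theorem one_sub_countOne_mul_countTwo_mulVec_ket (hmn : m ≠ n) (a b c : Fin d) :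
    ((1 - countOne d m - countOne d n) * countTwo d m) *ᵥ ket a b c =
      if m ≠ a ∧ n ≠ a ∧ m = b then ket a b c else 0 := by
  simp only [← mulVec_mulVec, countTwo_mulVec_ket, mulVec_smul, sub_mulVec, one_mulVec,
    countOne_mulVec_ket]
  split_ifs <;> first | simp; done | grind

/-- Apart from `ket a m n` with `a ∉ {m, n}`, the factors on the right and `j_3(Y)` leave no basis
vector; those on the left leave only `ket m n a`, which is reached once, by moving `n` into the
middle (a term of `Y`) and then exchanging `a` and `m` (a term of `X`). -/
theorem cycleOp_eq_mul (hm : m ∉ S) (hn : n ∉ insert m S) :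
    cycleOp d m n S =
      countOne d m * countTwo d n * (j d 3 (rowCol d m S) * j d 3 (rowCol d n (insert m S))) *
        ((1 - countOne d m - countOne d n) * countTwo d m) := by
  obtain ⟨hnm, hnS⟩ : n ≠ m ∧ n ∉ S := by simpa using hn
  refine ext_mulVec_ket fun a b c => ?_
  rw [cycleOp_mulVec_ket, ← mulVec_mulVec, one_sub_countOne_mul_countTwo_mulVec_ket hnm.symm]
  by_cases h_right : m ≠ a ∧ n ≠ a ∧ m = b
  swap
  · rw [if_neg h_right, mulVec_zero, if_neg]
    rintro ⟨ha, rfl, -⟩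
    exact h_right ⟨fun h => hm (h ▸ ha), fun h => hnS (h ▸ ha), rfl⟩
  rw [if_pos h_right, ← mulVec_mulVec, ← mulVec_mulVec _ (j d 3 _)]
  obtain ⟨hma, hna, rfl⟩ := h_right
  by_cases hnc : n = c
  swap
  · simp only [j_three_rowCol_mulVec_ket, hna, hnm, hnc, Ne.symm hnc, if_false, and_false, add_zero,
      mulVec_zero]
  subst hnc
  have h_outer : j d 3 (rowCol d n (insert m S)) *ᵥ ket a m n =
      (insert m S).card • ket a m n + (if a ∈ S then ket n m a else 0) + ket a n m := by
    simp [j_three_rowCol_mulVec_ket, hna, hnm, hma.symm]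
  rw [h_outer]
  by_cases haS : a ∈ S
  · simp only [haS, if_true, mulVec_add, mulVec_smul, j_three_rowCol_mulVec_ket, hma, hm, hnS, hnm,
      hnm.symm, if_false, zero_add, add_zero, countOne_mul_countTwo_mulVec_ket hnm.symm, and_self,
      false_and, and_false, smul_zero, hna]
  · simp only [haS, if_false, mulVec_add, mulVec_smul, j_three_rowCol_mulVec_ket, hma, hm, hnS, hnm,
      hnm.symm, if_true, zero_add, add_zero, false_and, smul_zero,
      countOne_mul_countTwo_mulVec_ket hnm.symm]

theorem cycleOp_mem_past (hm : m ∉ S) (hn : n ∉ insert m S) :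
    cycleOp d m n S ∈ past d (chainAlgebra d m n S) 3 := by
  have hem := e_mem_chainAlgebra_left (n := n) hm
  have hen := e_mem_chainAlgebra_right hn
  have j_three_mem {x : U d} (hx : x ∈ chainAlgebra d m n S) :=
    pastSet_subset_past _ (j_mem_pastSet (n := 2) hx)
  have embed_j_two_mem {x : U d} (hx : x ∈ chainAlgebra d m n S) :=
    pastSet_subset_past _ (embed_mem_pastSet (j_mem_pastSet (n := 1) hx))
  have embed_j_one_mem {x : U d} (hx : x ∈ chainAlgebra d m n S) :=
    pastSet_subset_past _ (embed_mem_pastSet (embed_mem_pastSet (j_mem_pastSet (n := 0) hx)))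
  rw [cycleOp_eq_mul hm hn]
  refine mul_mem (mul_mem (mul_mem ?_ ?_) (mul_mem ?_ ?_))
    (mul_mem (sub_mem (sub_mem (one_mem _) ?_) ?_) ?_)
  · exact embed_j_one_mem hem
  · exact embed_j_two_mem hen
  · exact j_three_mem (rowCol_mem_chainAlgebra_left hm)
  · exact j_three_mem (rowCol_mem_chainAlgebra_right hn)
  · exact embed_j_one_mem hem
  · exact embed_j_one_mem hen
  · exact embed_j_two_mem hem

end CycleOp

section Obstruction

variable {d : ℕ} {m n : Fin d} {S : Finset (Fin d)}

theorem lie_rowCol_P (hm : m ∉ S) (hn : n ∉ insert m S) :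
    ⁅rowCol d m S, P d (rowCol d m S * rowCol d n (insert m S) ^ 2)⁆ =
      (d : ℂ)⁻¹ • ⁅rowCol d m S, defect d m n S⁆ := by
  rw [P_eq_trace_matrixCoproduct, ← lie_rowCol_trace_matrixCoproduct hm hn]
  simp only [Ring.lie_def, mul_smul_comm, smul_mul_assoc, smul_sub]

theorem j_three_lie_rowCol_P_apply (hm : m ∉ S) (hn : n ∉ insert m S) {k : Fin d} (hk : k ∈ S) :
    j d 3 ⁅rowCol d m S, P d (rowCol d m S * rowCol d n (insert m S) ^ 2)⁆
      (triple k m n) (triple m n k) = (d : ℂ)⁻¹ * (1 - 2 * S.card) := by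
  obtain ⟨hnm, hnS⟩ : n ≠ m ∧ n ∉ S := by simpa using hn
  rw [lie_rowCol_P hm hn, map_smul, Matrix.smul_apply,
    j_three_lie_rowCol_defect_apply hm hnS hnm.symm hk, smul_eq_mul]

theorem one_sub_two_mul_natCast_ne_zero (s : ℕ) : (1 - 2 * s : ℂ) ≠ 0 := by
  rw [sub_ne_zero]
  norm_cast
  omega

theorem rowCol_mul_rowCol_sq_mem_chainAlgebra (hm : m ∉ S) (hn : n ∉ insert m S) :
    rowCol d m S * rowCol d n (insert m S) ^ 2 ∈ chainAlgebra d m n S :=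
  mul_mem (rowCol_mem_chainAlgebra_left hm) (pow_mem (rowCol_mem_chainAlgebra_right hn) 2)

theorem P_rowCol_mul_rowCol_sq_notMem_chainAlgebra (hS : S.Nonempty) (hm : m ∉ S)
    (hn : n ∉ insert m S) :
    P d (rowCol d m S * rowCol d n (insert m S) ^ 2) ∉ chainAlgebra d m n S := by
  intro h_mem
  obtain ⟨k, hk⟩ := hS
  have hd : (d : ℂ) ≠ 0 := Nat.cast_ne_zero.2 k.pos.ne'
  have h_entry := j_three_lie_rowCol_P_apply hm hn hk
  rw [(commute_rowCol_of_mem_chainAlgebra hm h_mem).lie_eq, map_zero, Matrix.zero_apply] at h_entry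
  exact mul_ne_zero (inv_ne_zero hd) (one_sub_two_mul_natCast_ne_zero S.card) h_entry.symm

theorem not_restrictsToMarkov_chainAlgebra (hS : S.Nonempty) (hm : m ∉ S) (hn : n ∉ insert m S) :
    ¬ RestrictsToMarkov d (chainAlgebra d m n S) := by
  intro h_markov
  obtain ⟨k, hk⟩ := hS
  have hd : (d : ℂ) ≠ 0 := Nat.cast_ne_zero.2 k.pos.ne'
  have hs : (S.card : ℂ) ≠ 0 := Nat.cast_ne_zero.2 (Finset.card_ne_zero_of_mem hk)
  have h_zero := h_markov.omega_j_lie_P_mul_eq_zero (rowCol_mem_chainAlgebra_left hm)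
    (fun _ => commute_rowCol_of_mem_chainAlgebra hm) (rowCol_mul_rowCol_sq_mem_chainAlgebra hm hn)
    (cycleOp_mem_past hm hn)
  rw [omega, trace_mul_cycleOp,
    Finset.sum_congr rfl fun _ => j_three_lie_rowCol_P_apply hm hn] at h_zero
  simp [hd, hs, one_sub_two_mul_natCast_ne_zero] at h_zero

end Obstruction

section Blocks

variable {d : ℕ}

/-- The finite set of the indices in block `r`. -/
def blockSet (d r : ℕ) : Finset (Fin d) :=
  Finset.univ.filter fun i => blockOf d i = r

theorem mem_blockSet {r : ℕ} {i : Fin d} : i ∈ blockSet d r ↔ blockOf d i = r := by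
  simp [blockSet]

theorem blockSet_two {m : Fin d} (hm : (m : ℕ) + 2 = d) : blockSet d 2 = {m} := by
  ext k
  rw [mem_blockSet, Finset.mem_singleton, Fin.ext_iff, blockOf]
  grind

theorem blockSet_three {n : Fin d} (hn : (n : ℕ) + 1 = d) : blockSet d 3 = {n} := by
  ext k
  rw [mem_blockSet, Finset.mem_singleton, Fin.ext_iff, blockOf]
  grind

theorem trace_block_mul_block (r s : ℕ) :
    (block d r s * block d s r).trace =
      ∑ i ∈ blockSet d r, ∑ k ∈ blockSet d s, e d i k * e d k i := by
  have sum_block (t : ℕ) (F : Fin d → U d) :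
      ∑ i ∈ blockSet d t, F i = ∑ i : {i : Fin d // blockOf d i = t}, F i :=
    Finset.sum_subtype _ (fun _ => mem_blockSet) F
  simp only [sum_block]
  rfl

theorem notMem_blockSet_one_of_add_two {m : Fin d} (hm : (m : ℕ) + 2 = d) : m ∉ blockSet d 1 := by
  rw [mem_blockSet, blockOf]
  grind

theorem notMem_blockSet_one_of_add_one {n : Fin d} (hn : (n : ℕ) + 1 = d) : n ∉ blockSet d 1 := by
  rw [mem_blockSet, blockOf]
  grind

theorem insert_insert_blockSet_one {m n : Fin d} (hm : (m : ℕ) + 2 = d) (hn : (n : ℕ) + 1 = d) :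
    insert n (insert m (blockSet d 1)) = Finset.univ := by
  ext k
  simp only [Finset.mem_insert, mem_blockSet, Finset.mem_univ, iff_true, Fin.ext_iff, blockOf]
  grind

theorem witness_eq {m n : Fin d} (hm : (m : ℕ) + 2 = d) (hn : (n : ℕ) + 1 = d) :
    witness d = rowCol d m (blockSet d 1) * rowCol d n (insert m (blockSet d 1)) ^ 2 := by
  have hm1 : m ∉ blockSet d 1 := notMem_blockSet_one_of_add_two hm
  simp only [witness, trace_block_mul_block, blockSet_two hm, blockSet_three hn,
    Finset.sum_singleton, rowCol, Finset.sum_insert hm1, add_comm (e d n m * e d m n)]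

/-- The inclusion of the first two blocks of indices. -/
def firstBlocks (d : ℕ) : {i : Fin d // blockOf d i = 1} ⊕ {i : Fin d // blockOf d i = 2} → Fin d :=
  Sum.elim Subtype.val Subtype.val

theorem firstBlocks_injective : Function.Injective (firstBlocks d) :=
  Subtype.val_injective.sumElim Subtype.val_injective fun i k h => by
    have h12 : (1 : ℕ) = 2 := i.2.symm.trans (h ▸ k.2)
    omega

theorem range_firstBlocks {m : Fin d} (hm : (m : ℕ) + 2 = d) :
    Set.range (firstBlocks d) = ↑(insert m (blockSet d 1)) := by
  ext k
  have h2 : blockOf d k = 2 ↔ k = m := by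
    rw [← mem_blockSet, blockSet_two hm, Finset.mem_singleton]
  simp [firstBlocks, mem_blockSet, h2, or_comm]

theorem minorAlgebra_eq_chainAlgebra {m n : Fin d} (hm : (m : ℕ) + 2 = d) (hn : (n : ℕ) + 1 = d) :
    minorAlgebra d = chainAlgebra d m n (blockSet d 1) := by
  have fromBlocks_eq : fromBlocks (block d 1 1) (block d 1 2) (block d 2 1) (block d 2 2) =
      (E d).submatrix (firstBlocks d) (firstBlocks d) := by
    ext (i | i) (k | k) <;> rfl
  have h1 (p : ℕ) : (block d 1 1 ^ p).trace = casimir d (blockSet d 1) p :=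
    trace_submatrix_pow Subtype.val_injective (by simp [blockSet]) p
  have h2 (p : ℕ) := trace_submatrix_pow firstBlocks_injective (range_firstBlocks hm) p
  have h3 (p : ℕ) : (E d ^ p).trace = casimir d Finset.univ p :=
    trace_submatrix_pow Function.injective_id (by simp) p
  simp only [minorAlgebra, chainAlgebra, fromBlocks_eq, h1, h2, h3,
    insert_insert_blockSet_one hm hn]

theorem exists_minorAlgebra_eq_chainAlgebra (hd : 3 ≤ d) :
    ∃ (m n : Fin d) (S : Finset (Fin d)), S.Nonempty ∧ m ∉ S ∧ n ∉ insert m S ∧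
      minorAlgebra d = chainAlgebra d m n S ∧
      witness d = rowCol d m S * rowCol d n (insert m S) ^ 2 := by
  obtain ⟨m, hm⟩ : ∃ m : Fin d, (m : ℕ) + 2 = d := ⟨⟨d - 2, by omega⟩, by grind⟩
  obtain ⟨n, hn⟩ : ∃ n : Fin d, (n : ℕ) + 1 = d := ⟨⟨d - 1, by omega⟩, by grind⟩
  have hnm : n ≠ m := by
    rintro rfl
    omega
  have zero_mem : (⟨0, by omega⟩ : Fin d) ∈ blockSet d 1 := mem_blockSet.2 (if_pos (by grind))
  exact ⟨m, n, blockSet d 1, ⟨_, zero_mem⟩, notMem_blockSet_one_of_add_two hm,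
    Finset.mem_insert.not.2 (not_or.2 ⟨hnm, notMem_blockSet_one_of_add_one hn⟩),
    minorAlgebra_eq_chainAlgebra hm hn, witness_eq hm hn⟩

end Blocks

end QuantumMinors

open QuantumMinors in
theorem mainTheorem2_general {d : ℕ} {m n : Fin d} {S : Finset (Fin d)} (hS : S.Nonempty)
    (hm : m ∉ S) (hn : n ∉ insert m S) :
    ¬ RestrictsToMarkov d (chainAlgebra d m n S) ∧
      rowCol d m S * rowCol d n (insert m S) ^ 2 ∈ chainAlgebra d m n S ∧
      P d (rowCol d m S * rowCol d n (insert m S) ^ 2) ∉ chainAlgebra d m n S :=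
  ⟨not_restrictsToMarkov_chainAlgebra hS hm hn, rowCol_mul_rowCol_sq_mem_chainAlgebra hm hn,
    P_rowCol_mul_rowCol_sq_notMem_chainAlgebra hS hm hn⟩

theorem mainTheorem2 (d : ℕ) (hd : 3 ≤ d) :
    ¬ QuantumMinors.RestrictsToMarkov d (QuantumMinors.minorAlgebra d) ∧
      QuantumMinors.witness d ∈ QuantumMinors.minorAlgebra d ∧
      QuantumMinors.P d (QuantumMinors.witness d) ∉ QuantumMinors.minorAlgebra d := by
  obtain ⟨m, n, S, hS, hm, hn, h_alg, h_wit⟩ := QuantumMinors.exists_minorAlgebra_eq_chainAlgebra hd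
  rw [h_alg, h_wit]
  exact mainTheorem2_general hS hm hn
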